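/- **Machine.** A machine has an unbounded slow memory and a fast memory of $M$ words; a load (store) copies one word from slow to fast (fast to slow) memory, arithmetic is done only on words in fast memory, and words of fast memory may be discarded or replaced by results at any time. *Sparse Cholesky factorization* of a real symmetric positive definite $N\times N$ matrix $B=LL^T$ means computing $$L_{jj}=\Big(B_{jj}-\sum_{k<j}L_{jk}^2\Big)^{1/2},\qquad L_{ij}=\Big(B_{ij}-\sum_{k<j}L_{ik}L_{jk}\Big)/L_{jj}\quad(i>j)$$ by these formulas: the terms of each sum are evaluated and accumulated in any order and grouping (partial sums may be kept, moved and added up), a product $L_{ik}L_{jk}$ may be omitted only if one of its factors is known to be zero, and each $L_{ij}$ is computed at most once. Initially the lower triangle of $B$ is in slow memory and fast memory is empty; at the end every entry of $L$ not known to be zero is present in fast or slow memory. **Grid.** Let the nodes of the $n\times n$ grid be joined to their horizontal and vertical nearest neighbours. A *five-point matrix* is a real $n^2\times n^2$ matrix $A$ indexed by the nodes, whose off-diagonal entry $A_{pq}$ is negative if $p,q$ are neighbours and $0$ otherwise (for example the discrete Laplacian, with diagonal entries $4$ and entries $-1$ at neighbours). **Theorem.** There is an absolute constant $c>0$ such that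 for all $n,M\ge 1$, every ordering of the $n^2$ grid nodes (diagonal pivot order, with permutation matrix $P$), and $B=PAP^T$, the following hold. 1. If $A$ is a five-point matrix and $B=LL^T$ with $L$ lower triangular with positive diagonal, then every execution of sparse Cholesky factorization of $B$ with fast memory of $M$ words, even if it treats every entry of $L$ that is equal to zero as known to be zero, moves (loads plus stores) at least $c\,n^3/\sqrt M$ words. 2. The same bound holds if $A$ is any real symmetric positive definite matrix with $A_{pq}\neq0$ for all neighbours $p,q$ (and arbitrary other entries), when the entries of $L$ known to be zero are those that are not structurally nonzero. Here the structurally nonzero entries form the smallest set of positions $(i,j)$, $j\le i$, that contains those with $B_{ij}\ne0$, and contains $(i,j)$ whenever it contains $(i,k)$ and $(j,k)$ for some $k<j\le i$. That is, sparse Cholesky factorization of the matrix of a five-point stencil on an $n\times n$ grid needs $\Omega(n^3/\sqrt M)$ words of communication. -/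

import Mathlib

namespace SparseCholesky

/-! ### Matrices of five-point stencils and their Cholesky factors -/

/-- The `n × n` grid graph: a node is joined to its horizontal and vertical nearest neighbours. -/
abbrev grid (n : ℕ) : SimpleGraph (Fin n × Fin n) :=
  SimpleGraph.boxProd (SimpleGraph.pathGraph n) (SimpleGraph.pathGraph n)

/-- `A` represents a five-point stencil on the grid (variable coefficients allowed): an off-diagonal
entry is negative at neighbouring nodes and zero otherwise. The standard example is the discrete
Laplacian, with diagonal entries `4` and the entries `-1` at neighbouring nodes. -/
def IsFivePointMatrix {n : ℕ} (A : Matrix (Fin n × Fin n) (Fin n × Fin n) ℝ) : Prop :=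
  ∀ p q, p ≠ q → ((grid n).Adj p q → A p q < 0) ∧ (¬ (grid n).Adj p q → A p q = 0)

/-- The matrix `P A Pᵀ` in which the node `p` has the position `σ p` (diagonal pivoting). -/
def reorder {n : ℕ} (A : Matrix (Fin n × Fin n) (Fin n × Fin n) ℝ)
    (σ : Fin n × Fin n ≃ Fin (n * n)) : Matrix (Fin (n * n)) (Fin (n * n)) ℝ :=
  A.submatrix σ.symm σ.symm

/-- `L` is the Cholesky factor of `B`. -/
def IsCholeskyFactor {N : ℕ} (B L : Matrix (Fin N) (Fin N) ℝ) : Prop :=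
  (∀ i j, i < j → L i j = 0) ∧ (∀ i, 0 < L i i) ∧ L * L.transpose = B

/-- The structurally nonzero entries `(i, j)`, `j ≤ i`, of the Cholesky factor of `B` (symbolic
factorization, no accidental cancellation): in
`L i j = (B i j - ∑ k < j, L i k * L j k) / L j j`
the entry `B i j` is nonzero or one of the products has two structurally nonzero factors. -/
inductive StructNonzero {N : ℕ} (B : Matrix (Fin N) (Fin N) ℝ) : Fin N → Fin N → Prop
  | input (i j : Fin N) : j ≤ i → B i j ≠ 0 → StructNonzero B i j
  | fill (i j k : Fin N) : k < j → j ≤ i → StructNonzero B i k → StructNonzero B j k →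
      StructNonzero B i j

/-! ### Cholesky factorization on a machine with a fast memory of `M` words -/

/-- What a word of memory may hold.
* `part i j K` is a partial sum of `B i j - ∑ k < j, L i k * L j k`: it contains the term `B i j` if
  `none ∈ K`, and the term `L i k * L j k` if `some k ∈ K`. In particular `part i j {none}` is
  the input entry `B i j`, and `part i j ∅` is an accumulator that holds `0`.
* `entry i j` is the finished entry `L i j`. -/
inductive Word (N : ℕ) : Type
  | part (i j : Fin N) (K : Finset (Option (Fin N)))
  | entry (i j : Fin N)
  deriving DecidableEq

/-- The contents of the fast and of the slow memory, and the set of entries of `L` computed so far.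
Slow memory is unbounded, so nothing in it ever has to be overwritten. -/
structure State (N : ℕ) : Type where
  fast : Finset (Word N)
  slow : Set (Word N)
  computed : Set (Fin N × Fin N)

/-- Initially the matrix (its lower triangle) is in slow memory, and fast memory is empty. -/
def State.initial (N : ℕ) : State N where
  fast := ∅
  slow := {w | ∃ i j : Fin N, j ≤ i ∧ w = Word.part i j {none}}
  computed := ∅

/-- `Step M B Nz s d t`: one instruction leads from the state `s` to the state `t` and moves `d` words
between fast and slow memory. `M` is the size of fast memory, `B` the matrix to be factored,
and `Nz i j` says that `L i j` is not known to be zero: a product `L i k * L j k` may be left out of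
the sum for `L i j` only if one of its factors is known to be zero. Arithmetic is done only on words
in fast memory, a result may replace any word there (such as one of its operands), and each entry
of `L` is computed at most once. -/
inductive Step {N : ℕ} (M : ℕ) (B : Matrix (Fin N) (Fin N) ℝ) (Nz : Fin N → Fin N → Prop) :
    State N → ℕ → State N → Prop
  /-- Copy a word from slow to fast memory. -/
  | load (s : State N) (w : Word N) (F : Finset (Word N)) :
      w ∈ s.slow → F ⊆ insert w s.fast → F.card ≤ M →
      Step M B Nz s 1 { s with fast := F }
  /-- Copy a word from fast to slow memory. -/
  | store (s : State N) (w : Word N) :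
      w ∈ s.fast → Step M B Nz s 1 { s with slow := insert w s.slow }
  /-- Discard words of fast memory. -/
  | discard (s : State N) (F : Finset (Word N)) :
      F ⊆ s.fast → Step M B Nz s 0 { s with fast := F }
  /-- Start an accumulator at zero. -/
  | zero (s : State N) (i j : Fin N) (F : Finset (Word N)) :
      j ≤ i → F ⊆ insert (Word.part i j ∅) s.fast → F.card ≤ M →
      Step M B Nz s 0 { s with fast := F }
  /-- Multiply `L i k` by `L j k`, and accumulate the product. -/
  | multiply (s : State N) (i j k : Fin N) (K : Finset (Option (Fin N))) (F : Finset (Word N)) :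
      k < j → j ≤ i → some k ∉ K →
      Word.entry i k ∈ s.fast → Word.entry j k ∈ s.fast → Word.part i j K ∈ s.fast →
      F ⊆ insert (Word.part i j (insert (some k) K)) s.fast → F.card ≤ M →
      Step M B Nz s 0 { s with fast := F }
  /-- Add two partial sums without common terms. -/
  | add (s : State N) (i j : Fin N) (K K' : Finset (Option (Fin N))) (F : Finset (Word N)) :
      Disjoint K K' → Word.part i j K ∈ s.fast → Word.part i j K' ∈ s.fast →
      F ⊆ insert (Word.part i j (K ∪ K')) s.fast → F.card ≤ M →
      Step M B Nz s 0 { s with fast := F }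
  /-- Finish `L i j`: divide the completed sum by `L j j` if `j < i`, take its root if `j = i`. -/
  | finish (s : State N) (i j : Fin N) (K : Finset (Option (Fin N))) (F : Finset (Word N)) :
      j ≤ i → (i, j) ∉ s.computed → Word.part i j K ∈ s.fast →
      (B i j ≠ 0 → none ∈ K) → (∀ k, k < j → Nz i k → Nz j k → some k ∈ K) →
      (j < i → Word.entry j j ∈ s.fast) →
      F ⊆ insert (Word.entry i j) s.fast → F.card ≤ M →
      Step M B Nz s 0 { s with fast := F, computed := insert (i, j) s.computed }

/-- `Run M B Nz s W t`: a finite sequence of instructions leads from `s` to `t`, and `W` is its total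
number of words moved (loads and stores). -/
inductive Run {N : ℕ} (M : ℕ) (B : Matrix (Fin N) (Fin N) ℝ) (Nz : Fin N → Fin N → Prop) :
    State N → ℕ → State N → Prop
  | nil (s : State N) : Run M B Nz s 0 s
  | snoc (s t u : State N) (W d : ℕ) :
      Run M B Nz s W t → Step M B Nz t d u → Run M B Nz s (W + d) u

/-- Some execution on a machine with a fast memory of `M` words computes the Cholesky factorization
of `B`, with the nonzero structure `Nz` of the factor, by moving exactly `W` words: in the end every
entry `L i j` that is not known to be zero is available in fast or slow memory. -/
def FactorsWith {N : ℕ} (M : ℕ) (B : Matrix (Fin N) (Fin N) ℝ) (Nz : Fin N → Fin N → Prop)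
    (W : ℕ) : Prop :=
  ∃ t : State N, Run M B Nz (State.initial N) W t ∧
    ∀ i j : Fin N, j ≤ i → Nz i j → Word.entry i j ∈ t.fast ∨ Word.entry i j ∈ t.slow

end SparseCholesky

/-! Every ordering of the grid forces a dense block of order `n - 1` in the factor
(`exists_clique`). Eliminate nodes in order until a row or column is complete for the first time,
say a row. It is a connected set of eliminated nodes, and every column, except perhaps that of the
last node, still has an uneliminated node, hence also one adjacent to the eliminated component of
the row. These `n - 1` nodes are pairwise joined by paths through eliminated nodes, so they fill in.
For a five-point matrix the off-diagonal entries of `L` are nonpositive, so nothing cancels and fill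
is numerically nonzero.

A dense block of order `3m` needs at least `m ^ 3` products. Cut the execution into segments moving
about `M` words. The products formed in one segment touch at most `3M` positions
(`exists_positions`), hence number at most `(3M)^(3/2)` by Loomis–Whitney. With `m` of order `n`
this gives `n ^ 3 ≲ M^(3/2) * (W / M + 1)`. The extra `1` is harmless because all `n ^ 2` diagonal
entries must be loaded (`card_diag_le`). -/

namespace SparseCholesky

/-! ### Fill paths and dense blocks of the filled graph -/

/-- There is a path of `G` from `u` to `v` whose interior nodes have positions less than `t`. -/
inductive FillPath {N : ℕ} (G : SimpleGraph (Fin N)) (t : ℕ) (u : Fin N) : Fin N → Prop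
  | edge (v : Fin N) : G.Adj u v → FillPath G t u v
  | step (w v : Fin N) : FillPath G t u w → (w : ℕ) < t → G.Adj w v → FillPath G t u v

/-- Only one node has position `t`. Cutting at its first and last visits, and dropping any loop
between them, leaves pieces with interiors below `t`. -/
theorem FillPath.split {N : ℕ} {G : SimpleGraph (Fin N)} {t : ℕ} {u v : Fin N}
    (h : FillPath G (t + 1) u v) :
    FillPath G t u v ∨ ∃ w : Fin N, (w : ℕ) = t ∧ FillPath G t u w ∧ FillPath G t w v := by
  induction h with
  | edge v h => exact Or.inl (.edge v h)
  | step x v _ hx hxv ih =>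
    rcases Nat.lt_succ_iff_lt_or_eq.1 hx with hlt | heq
    · rcases ih with ih | ⟨w, hw, h1, h2⟩
      · exact Or.inl (.step x v ih hlt hxv)
      · exact Or.inr ⟨w, hw, h1, .step x v h2 hlt hxv⟩
    · rcases ih with ih | ⟨w, hw, h1, h2⟩
      · exact Or.inr ⟨x, heq, ih, .edge v hxv⟩
      · obtain rfl : w = x := Fin.ext (hw.trans heq.symm)
        exact Or.inr ⟨w, hw, h1, .edge v hxv⟩

/-- One half of the Rose–Tarjan–Lueker fill path theorem: the two pieces at the cut node `w` give
nonzeros in column `w`, which fill the position of `u` and `v`. Both orders of `u` and `v` are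
carried because only the lower triangle is recorded. -/
theorem FillPath.structNonzero {N : ℕ} {G : SimpleGraph (Fin N)} {B : Matrix (Fin N) (Fin N) ℝ}
    (hG : ∀ i j, G.Adj i j → B i j ≠ 0) (t : ℕ) :
    ∀ u v : Fin N, FillPath G t u v → t ≤ u → t ≤ v →
      (v ≤ u → StructNonzero B u v) ∧ (u ≤ v → StructNonzero B v u) := by
  induction t with
  | zero =>
    intro u v h _ _
    cases h with
    | edge _ h => exact ⟨fun h' => .input _ _ h' (hG _ _ h), fun h' => .input _ _ h' (hG _ _ h.symm)⟩
    | step w _ _ hw _ => exact absurd hw (Nat.not_lt_zero _)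
  | succ t ih =>
    intro u v h hu hv
    rcases h.split with h | ⟨w, hw, h1, h2⟩
    · exact ih u v h (by omega) (by omega)
    · have hwu : w < u := by rw [Fin.lt_def]; omega
      have hwv : w < v := by rw [Fin.lt_def]; omega
      have h3 := (ih u w h1 (by omega) (by omega)).1 hwu.le
      have h4 := (ih w v h2 (by omega) (by omega)).2 hwv.le
      exact ⟨fun h => .fill _ _ w hwv h h3 h4, fun h => .fill _ _ w hwu h h4 h3⟩

/-- Two nodes are joined by a path of `G` all of whose nodes have positions less than `t`. -/
def LowConnected {N : ℕ} (G : SimpleGraph (Fin N)) (t : ℕ) : Fin N → Fin N → Prop :=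
  Relation.ReflTransGen fun x y => (x : ℕ) < t ∧ (y : ℕ) < t ∧ G.Adj x y

theorem LowConnected.symm {N : ℕ} {G : SimpleGraph (Fin N)} {t : ℕ} {x y : Fin N}
    (h : LowConnected G t x y) : LowConnected G t y x := by
  induction h with
  | refl => exact .refl
  | tail _ h ih => exact .head ⟨h.2.1, h.1, h.2.2.symm⟩ ih

theorem FillPath.trans_lowConnected {N : ℕ} {G : SimpleGraph (Fin N)} {t : ℕ} {u x y : Fin N}
    (h : LowConnected G t x y) (hu : FillPath G t u x) : FillPath G t u y := by
  induction h with
  | refl => exact hu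
  | tail _ h ih => exact .step _ _ ih h.1 h.2.2

theorem pathGraph_induction {n : ℕ} {C : Fin n → Prop} {r : Fin n} (hr : C r)
    (hC : ∀ i i', (SimpleGraph.pathGraph n).Adj i i' → C i → C i') (i : Fin n) : C i := by
  obtain ⟨p⟩ := SimpleGraph.pathGraph_preconnected n r i
  induction p with
  | nil => exact hr
  | cons h _ ih => exact ih (hC _ _ h hr)

/-- Otherwise low connection to `g r` would spread along the whole column and leave no node at or
above `t`. -/
theorem exists_boundary_in_column {n N : ℕ} {G : SimpleGraph (Fin N)} {t : ℕ}
    {g : Fin n → Fin N} (hg : ∀ i i', (SimpleGraph.pathGraph n).Adj i i' → G.Adj (g i) (g i'))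
    {r : Fin n} (hr : (g r : ℕ) < t) (hne : ∃ i, t ≤ (g i : ℕ)) :
    ∃ i, t ≤ (g i : ℕ) ∧ ∃ x : Fin N, (x : ℕ) < t ∧ G.Adj x (g i) ∧ LowConnected G t (g r) x := by
  by_contra hcon
  push Not at hcon
  have key := pathGraph_induction (C := fun i => (g i : ℕ) < t ∧ LowConnected G t (g r) (g i))
    ⟨hr, .refl⟩ (fun i i' h hi => by
      have hi' : (g i' : ℕ) < t := by
        by_contra hge
        exact hcon i' (not_lt.1 hge) (g i) hi.1 (hg _ _ h) hi.2
      exact ⟨hi', hi.2.tail ⟨hi.1, hi', hg _ _ h⟩⟩)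
  obtain ⟨i, hi⟩ := hne
  exact absurd (key i).1 (not_lt.2 hi)

/-- If the row `r` of an `n × n` grid is numbered before some node of every column but one, then
`n - 1` nodes of the grid become pairwise adjacent in the filled graph. -/
theorem exists_clique_of_row {n N : ℕ} {G : SimpleGraph (Fin N)} {B : Matrix (Fin N) (Fin N) ℝ}
    (hG : ∀ i j, G.Adj i j → B i j ≠ 0) {f : Fin n → Fin n → Fin N}
    (hf : ∀ i j i' j', f i j = f i' j' → j = j')
    (hrow : ∀ i j j', (SimpleGraph.pathGraph n).Adj j j' → G.Adj (f i j) (f i j'))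
    (hcol : ∀ j i i', (SimpleGraph.pathGraph n).Adj i i' → G.Adj (f i j) (f i' j))
    (r j₀ : Fin n) (hr : ∀ j, f r j ≤ f r j₀) (hc : ∀ j, j ≠ j₀ → ∃ i, f r j₀ < f i j) :
    ∃ S : Finset (Fin N), n ≤ S.card + 1 ∧ ∀ i ∈ S, ∀ j ∈ S, j ≤ i → StructNonzero B i j := by
  classical
  set t : ℕ := (f r j₀ : ℕ) + 1 with ht
  have hrt : ∀ j, (f r j : ℕ) < t := fun j => Nat.lt_succ_of_le (hr j)
  have hb : ∀ j : {j : Fin n // j ≠ j₀}, ∃ i, t ≤ (f i j : ℕ) ∧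
      ∃ x : Fin N, (x : ℕ) < t ∧ G.Adj x (f i j) ∧ LowConnected G t (f r j) x := fun j =>
    exists_boundary_in_column (g := fun i => f i j) (fun i i' h => hcol j i i' h) (hrt j) (by
      obtain ⟨i, hi⟩ := hc j j.2
      exact ⟨i, hi⟩)
  choose s hs x hx hadj hconn using hb
  have hinj : Function.Injective fun j : {j : Fin n // j ≠ j₀} => f (s j) j :=
    fun j j' h => Subtype.ext (hf _ _ _ _ h)
  have hline : ∀ j j', LowConnected G t (f r j) (f r j') := fun j j' =>
    pathGraph_induction (C := fun j' => LowConnected G t (f r j) (f r j')) .refl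
      (fun i i' h hi => hi.tail ⟨hrt i, hrt i', hrow r i i' h⟩) j'
  refine ⟨Finset.univ.image fun j : {j : Fin n // j ≠ j₀} => f (s j) j, ?_, ?_⟩
  · rw [Finset.card_image_of_injective _ hinj, Finset.card_univ, Fintype.card_subtype_compl]
    simp
    omega
  · intro i hi j hj hji
    obtain ⟨a, -, rfl⟩ := Finset.mem_image.1 hi
    obtain ⟨b, -, rfl⟩ := Finset.mem_image.1 hj
    have hab : LowConnected G t (x a) (x b) :=
      (hconn a).symm.trans ((hline a b).trans (hconn b))
    have hp : FillPath G t (f (s a) a) (f (s b) b) :=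
      .step _ _ (FillPath.trans_lowConnected hab (.edge _ (hadj a).symm)) (hx b) (hadj b)
    exact (FillPath.structNonzero hG t _ _ hp (hs a) (hs b)).1 hji

/-- For every ordering of the `n × n` grid, the factor has a dense block of order `n - 1`. -/
theorem exists_clique {n N : ℕ} (hn : 1 ≤ n) {B : Matrix (Fin N) (Fin N) ℝ}
    (σ : Fin n × Fin n ≃ Fin N)
    (hadj : ∀ p q, (grid n).Adj p q → B (σ p) (σ q) ≠ 0) :
    ∃ S : Finset (Fin N), n ≤ S.card + 1 ∧ ∀ i ∈ S, ∀ j ∈ S, j ≤ i → StructNonzero B i j := by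
  have : Nonempty (Fin n) := ⟨⟨0, hn⟩⟩
  let G : SimpleGraph (Fin N) := (grid n).comap σ.symm
  have hG : ∀ i j, G.Adj i j → B i j ≠ 0 := fun i j h => by
    simpa using hadj _ _ (SimpleGraph.comap_adj.1 h)
  have hrow : ∀ i j j', (SimpleGraph.pathGraph n).Adj j j' → G.Adj (σ (i, j)) (σ (i, j')) := by
    intro i j j' h
    simp [G, SimpleGraph.boxProd_adj, h]
  have hcol : ∀ j i i', (SimpleGraph.pathGraph n).Adj i i' → G.Adj (σ (i, j)) (σ (i', j)) := by
    intro i j j' h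
    simp [G, SimpleGraph.boxProd_adj, h]
  choose jr hjr using fun r : Fin n => Finite.exists_max fun j => σ (r, j)
  choose ic hic using fun c : Fin n => Finite.exists_max fun i => σ (i, c)
  obtain ⟨r, hr⟩ := Finite.exists_min fun r => σ (r, jr r)
  obtain ⟨c, hc⟩ := Finite.exists_min fun c => σ (ic c, c)
  -- Use the line completed first. Each line of the other direction ends no earlier, and ends
  -- strictly later unless both share their last node.
  rcases le_total (σ (r, jr r)) (σ (ic c, c)) with h | h
  · refine exists_clique_of_row (f := fun i j => σ (i, j)) hG
      (fun i j i' j' h => (Prod.ext_iff.1 (σ.injective h)).2) hrow hcol r (jr r) (hjr r)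
      fun j hj => ⟨ic j, lt_of_le_of_ne (h.trans (hc j)) fun he => hj ?_⟩
    exact (Prod.ext_iff.1 (σ.injective he)).2.symm
  · refine exists_clique_of_row (f := fun i j => σ (j, i)) hG
      (fun i j i' j' h => (Prod.ext_iff.1 (σ.injective h)).1) hcol hrow c (ic c) (hic c)
      fun j hj => ⟨jr j, lt_of_le_of_ne (h.trans (hr j)) fun he => hj ?_⟩
    exact (Prod.ext_iff.1 (σ.injective he)).1.symm

/-! ### No cancellation in the factor of a five-point matrix -/

theorem IsCholeskyFactor.apply {N : ℕ} {B L : Matrix (Fin N) (Fin N) ℝ}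
    (h : IsCholeskyFactor B L) {i j : Fin N} :
    B i j = L i j * L j j + ∑ k ∈ Finset.Iio j, L i k * L j k := by
  have h1 : B i j = ∑ k, L i k * L j k := by
    rw [← h.2.2, Matrix.mul_apply]; rfl
  rw [h1, ← Finset.sum_insert (f := fun k => L i k * L j k) (a := j) (by simp)]
  refine (Finset.sum_subset (Finset.subset_univ _) fun k _ hk => ?_).symm
  have : j < k := by
    simp only [Finset.mem_insert, Finset.mem_Iio, not_or, not_lt] at hk
    exact lt_of_le_of_ne hk.2 (Ne.symm hk.1)
  rw [h.1 j k this, mul_zero]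

theorem IsCholeskyFactor.diag_pos {N : ℕ} {B L : Matrix (Fin N) (Fin N) ℝ}
    (h : IsCholeskyFactor B L) (i : Fin N) : 0 < B i i := by
  rw [h.apply]
  exact add_pos_of_pos_of_nonneg (mul_pos (h.2.1 i) (h.2.1 i))
    (Finset.sum_nonneg fun k _ => mul_self_nonneg _)

/-- Column by column: in earlier columns the factors are nonpositive, so a nonnegative sum is
subtracted from `B i j ≤ 0`. -/
theorem IsCholeskyFactor.nonpos {N : ℕ} {B L : Matrix (Fin N) (Fin N) ℝ}
    (h : IsCholeskyFactor B L) (hB : ∀ i j, i ≠ j → B i j ≤ 0) (j : Fin N) :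
    ∀ i, j < i → L i j ≤ 0 := by
  induction j using WellFoundedLT.induction with
  | ind j ih =>
    intro i hij
    have hs : 0 ≤ ∑ k ∈ Finset.Iio j, L i k * L j k := Finset.sum_nonneg fun k hk => by
      have hk := Finset.mem_Iio.1 hk
      exact mul_nonneg_of_nonpos_of_nonpos (ih k hk i (hk.trans hij)) (ih k hk j hk)
    have h1 := h.apply (i := i) (j := j)
    have h2 := hB i j hij.ne'
    have h3 := h.2.1 j
    by_contra! hpos
    nlinarith [mul_pos hpos h3]

theorem IsCholeskyFactor.ne_zero_of_structNonzero {N : ℕ} {B L : Matrix (Fin N) (Fin N) ℝ}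
    (h : IsCholeskyFactor B L) (hB : ∀ i j, i ≠ j → B i j ≤ 0) {i j : Fin N}
    (hs : StructNonzero B i j) : L i j ≠ 0 := by
  have hnn : ∀ i j : Fin N, j < i → ∀ k ∈ Finset.Iio j, 0 ≤ L i k * L j k := fun i j hij k hk => by
    have hk := Finset.mem_Iio.1 hk
    exact mul_nonneg_of_nonpos_of_nonpos (h.nonpos hB k i (hk.trans hij)) (h.nonpos hB k j hk)
  induction hs with
  | input i j hji hij =>
    rcases hji.eq_or_lt with rfl | hlt
    · exact (h.2.1 _).ne'
    · intro h0
      have h1 := h.apply (i := i) (j := j)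
      have h2 := Finset.sum_nonneg (hnn i j hlt)
      rw [h0, zero_mul, zero_add] at h1
      exact hij (le_antisymm (hB i j hlt.ne') (h1 ▸ h2))
  | fill i j k hkj hji _ _ hik hjk =>
    rcases hji.eq_or_lt with rfl | hlt
    · exact (h.2.1 _).ne'
    · intro h0
      have h1 := h.apply (i := i) (j := j)
      have h2 := Finset.single_le_sum (hnn i j hlt) (Finset.mem_Iio.2 hkj)
      have h3 := (hnn i j hlt k (Finset.mem_Iio.2 hkj)).lt_of_ne' (mul_ne_zero hik hjk)
      rw [h0, zero_mul, zero_add] at h1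
      linarith [hB i j hlt.ne']

end SparseCholesky

namespace SparseCholesky

/-! ### A discrete Loomis–Whitney inequality -/

/-- Fibre `D` over `(i, j)` and apply Cauchy–Schwarz. Two points `(i, j, k)`, `(i, j, k')` of one
fibre are determined by `(i, k)` and `(j, k')`, so the squared fibre sizes add up to at most `P.card
^ 2`. -/
theorem card_sq_le_card_pow_three {α : Type*} [DecidableEq α] (D : Finset (α × α × α))
    (P : Finset (α × α)) (hD : ∀ i j k, (i, j, k) ∈ D → (i, j) ∈ P ∧ (i, k) ∈ P ∧ (j, k) ∈ P) :
    D.card ^ 2 ≤ P.card ^ 3 := by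
  let fib : α × α → Finset (α × α × α) := fun p => {d ∈ D | (d.1, d.2.1) = p}
  have h1 : D.card = ∑ p ∈ P, (fib p).card :=
    Finset.card_eq_sum_card_fiberwise fun d hd => (hD d.1 d.2.1 d.2.2 hd).1
  have h2 : ∑ p ∈ P, (fib p).card ^ 2 ≤ (P ×ˢ P).card := by
    have h3 : ∑ p ∈ P, (fib p).card ^ 2 = (P.sigma fun p => fib p ×ˢ fib p).card := by
      simp [Finset.card_sigma, sq]
    rw [h3]
    refine Finset.card_le_card_of_injOn
      (fun x => ((x.2.1.1, x.2.1.2.2), (x.2.2.2.1, x.2.2.2.2))) ?_ ?_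
    · rintro ⟨p, d, e⟩ hx
      simp only [fib, Finset.coe_sigma, Set.mem_sigma_iff, Finset.mem_coe, Finset.mem_product,
        Finset.mem_filter] at hx ⊢
      exact ⟨(hD _ _ _ hx.2.1.1).2.1, (hD _ _ _ hx.2.2.1).2.2⟩
    · rintro ⟨p, d, e⟩ hx ⟨p', d', e'⟩ hx' h
      simp only [fib, Finset.coe_sigma, Set.mem_sigma_iff, Finset.mem_coe, Finset.mem_product,
        Finset.mem_filter] at hx hx'
      obtain ⟨-, ⟨-, rfl⟩, -, hx⟩ := hx
      obtain ⟨-, ⟨-, rfl⟩, -, hx'⟩ := hx'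
      obtain ⟨i, j, k⟩ := d
      obtain ⟨i', j', k'⟩ := d'
      obtain ⟨a, b, c⟩ := e
      obtain ⟨a', b', c'⟩ := e'
      simp only [Prod.mk.injEq] at h hx hx'
      obtain ⟨⟨rfl, rfl⟩, rfl, rfl⟩ := h
      obtain ⟨rfl, rfl⟩ := hx
      obtain ⟨rfl, rfl⟩ := hx'
      rfl
  calc D.card ^ 2 = (∑ p ∈ P, (fib p).card) ^ 2 := by rw [h1]
    _ ≤ P.card * ∑ p ∈ P, (fib p).card ^ 2 := sq_sum_le_card_mul_sum_sq
    _ ≤ P.card * (P ×ˢ P).card := Nat.mul_le_mul_left _ h2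
    _ = P.card ^ 3 := by rw [Finset.card_product]; ring

/-! ### What a single instruction can do -/

variable {N M : ℕ} {B : Matrix (Fin N) (Fin N) ℝ} {Nz : Fin N → Fin N → Prop}

/-- The position in the matrix to which a word belongs. -/
def Word.pos : Word N → Fin N × Fin N
  | .part i j _ => (i, j)
  | .entry i j => (i, j)

theorem Step.slow_subset {s t : State N} {d : ℕ} (h : Step M B Nz s d t) : s.slow ⊆ t.slow := by
  cases h <;> first | exact subset_rfl | exact Set.subset_insert _ _

theorem Step.computed_subset {s t : State N} {d : ℕ} (h : Step M B Nz s d t) :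
    s.computed ⊆ t.computed := by
  cases h <;> first | exact subset_rfl | exact Set.subset_insert _ _

theorem Step.card_fast_le {s t : State N} {d : ℕ} (h : Step M B Nz s d t)
    (hs : s.fast.card ≤ M) : t.fast.card ≤ M := by
  cases h <;> first | assumption | exact (Finset.card_le_card ‹_›).trans hs

theorem Step.cost_le_one {s t : State N} {d : ℕ} (h : Step M B Nz s d t) : d ≤ 1 := by
  cases h <;> simp

/-- The words moved by an instruction. -/
theorem Step.exists_moved {s t : State N} {d : ℕ} (h : Step M B Nz s d t) :
    ∃ X : Finset (Word N), X.card ≤ d ∧ (∀ w ∈ t.slow, w ∈ s.slow ∨ w ∈ X) ∧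
      ∀ i j, Word.entry i j ∈ t.fast →
        Word.entry i j ∈ s.fast ∨ Word.entry i j ∈ X ∨ (i, j) ∉ s.computed := by
  cases h with
  | load w F _ hF _ =>
    refine ⟨{w}, by simp, fun _ h => Or.inl h, fun i j h => ?_⟩
    have := hF h
    simp only [Finset.mem_insert, Finset.mem_singleton] at this ⊢
    tauto
  | store w hw =>
    refine ⟨{w}, by simp, fun v h => ?_, fun i j h => Or.inl h⟩
    simp only [Set.mem_insert_iff, Finset.mem_singleton] at h ⊢
    tauto
  | discard F hF => exact ⟨∅, by simp, fun _ h => Or.inl h, fun i j h => Or.inl (hF h)⟩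
  | finish i j K F _ hc _ _ _ _ hF _ =>
    refine ⟨∅, by simp, fun _ h => Or.inl h, fun i' j' h => ?_⟩
    rcases Finset.mem_insert.1 (hF h) with h | h
    · cases h
      exact Or.inr (Or.inr hc)
    · exact Or.inl h
  | zero i j F _ hF _ =>
    exact ⟨∅, by simp, fun _ h => Or.inl h, fun i' j' h => Or.inl (by simpa using hF h)⟩
  | multiply i j k K F _ _ _ _ _ _ hF _ =>
    exact ⟨∅, by simp, fun _ h => Or.inl h, fun i' j' h => Or.inl (by simpa using hF h)⟩
  | add i j K K' F _ _ _ hF _ =>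
    exact ⟨∅, by simp, fun _ h => Or.inl h, fun i' j' h => Or.inl (by simpa using hF h)⟩

/-- The word is in fast or in slow memory. -/
def State.Avail (s : State N) (w : Word N) : Prop := w ∈ s.fast ∨ w ∈ s.slow

/-- Entries in memory have been computed. -/
theorem Step.computed_of_avail {s t : State N} {d : ℕ} (h : Step M B Nz s d t)
    (hs : ∀ i j, s.Avail (.entry i j) → (i, j) ∈ s.computed) (i j : Fin N)
    (ht : t.Avail (.entry i j)) : (i, j) ∈ t.computed := by
  have h0 := hs i j
  unfold State.Avail at h0 ht
  cases h with
  | load w F hw hF _ =>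
    rcases ht with ht | ht
    · rcases Finset.mem_insert.1 (hF ht) with rfl | ht <;> tauto
    · tauto
  | store w hw =>
    rcases ht with ht | ht
    · tauto
    · rcases Set.mem_insert_iff.1 ht with rfl | ht <;> tauto
  | discard F hF => exact h0 (ht.imp_left fun h => hF h)
  | zero i' j' F _ hF _ => exact h0 (ht.imp_left fun h => by simpa using hF h)
  | multiply i' j' k K F _ _ _ _ _ _ hF _ => exact h0 (ht.imp_left fun h => by simpa using hF h)
  | add i' j' K K' F _ _ _ hF _ => exact h0 (ht.imp_left fun h => by simpa using hF h)
  | finish i' j' K F _ hc _ _ _ _ hF _ =>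
    rcases ht with ht | ht
    · rcases Finset.mem_insert.1 (hF ht) with h | h
      · cases h
        exact Or.inl rfl
      · exact Or.inr (h0 (Or.inl h))
    · exact Or.inr (h0 (Or.inr ht))

/-- A computed entry that is in neither memory is lost for ever. -/
theorem Step.avail_of_computed {s t : State N} {d : ℕ} (h : Step M B Nz s d t) {i j : Fin N}
    (hc : (i, j) ∈ s.computed) (ht : t.Avail (.entry i j)) : s.Avail (.entry i j) := by
  unfold State.Avail at ht ⊢
  cases h with
  | load w F hw hF _ =>
    rcases ht with ht | ht
    · rcases Finset.mem_insert.1 (hF ht) with rfl | ht <;> tauto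
    · tauto
  | store w hw =>
    rcases ht with ht | ht
    · tauto
    · rcases Set.mem_insert_iff.1 ht with rfl | ht <;> tauto
  | discard F hF => exact ht.imp_left fun h => hF h
  | zero i' j' F _ hF _ => exact ht.imp_left fun h => by simpa using hF h
  | multiply i' j' k K F _ _ _ _ _ _ hF _ => exact ht.imp_left fun h => by simpa using hF h
  | add i' j' K K' F _ _ _ hF _ => exact ht.imp_left fun h => by simpa using hF h
  | finish i' j' K F _ hc' _ _ _ _ hF _ =>
    refine ht.imp_left fun ht => ?_
    rcases Finset.mem_insert.1 (hF ht) with h | h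
    · cases h
      exact absurd hc hc'
    · exact h

/-! ### Formation and retention of products -/

/-- The state retains the term `x` of the sum for `L i j`: it is contained in some partial sum in
memory, or `L i j` is finished. -/
def State.Holds (s : State N) (i j : Fin N) (x : Option (Fin N)) : Prop :=
  (∃ K, x ∈ K ∧ s.Avail (.part i j K)) ∨ (i, j) ∈ s.computed

/-- A product is retained for the first time when it is formed. -/
theorem Step.multiplied {s t : State N} {d : ℕ} (h : Step M B Nz s d t) {i j k : Fin N}
    (hkj : k < j) (hik : Nz i k) (hjk : Nz j k) (hs : ¬ s.Holds i j (some k))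
    (ht : t.Holds i j (some k)) : Word.entry i k ∈ s.fast ∧ Word.entry j k ∈ s.fast := by
  unfold State.Holds State.Avail at hs ht
  push Not at hs
  obtain ⟨hs, hc⟩ := hs
  cases h with
  | load w F hw hF _ =>
    rcases ht with ⟨K, hK, ht | ht⟩ | ht
    · rcases Finset.mem_insert.1 (hF ht) with rfl | ht
      · exact absurd hw (hs K hK).2
      · exact absurd ht (hs K hK).1
    · exact absurd ht (hs K hK).2
    · exact absurd ht hc
  | store w hw =>
    rcases ht with ⟨K, hK, ht | ht⟩ | ht
    · exact absurd ht (hs K hK).1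
    · rcases Set.mem_insert_iff.1 ht with rfl | ht
      · exact absurd hw (hs K hK).1
      · exact absurd ht (hs K hK).2
    · exact absurd ht hc
  | discard F hF =>
    rcases ht with ⟨K, hK, ht | ht⟩ | ht
    · exact absurd (hF ht) (hs K hK).1
    · exact absurd ht (hs K hK).2
    · exact absurd ht hc
  | zero i' j' F _ hF _ =>
    rcases ht with ⟨K, hK, ht | ht⟩ | ht
    · rcases Finset.mem_insert.1 (hF ht) with h | ht
      · cases h
        exact absurd hK (Finset.notMem_empty _)
      · exact absurd ht (hs K hK).1
    · exact absurd ht (hs K hK).2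
    · exact absurd ht hc
  | multiply i' j' k' K' F _ _ _ h1 h2 h3 hF _ =>
    rcases ht with ⟨K, hK, ht | ht⟩ | ht
    · rcases Finset.mem_insert.1 (hF ht) with h | ht
      · cases h
        rcases Finset.mem_insert.1 hK with h | h
        · cases h
          exact ⟨h1, h2⟩
        · exact absurd h3 (hs K' h).1
      · exact absurd ht (hs K hK).1
    · exact absurd ht (hs K hK).2
    · exact absurd ht hc
  | add i' j' K₁ K₂ F _ h1 h2 hF _ =>
    rcases ht with ⟨K, hK, ht | ht⟩ | ht
    · rcases Finset.mem_insert.1 (hF ht) with h | ht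
      · cases h
        rcases Finset.mem_union.1 hK with h | h
        · exact absurd h1 (hs _ h).1
        · exact absurd h2 (hs _ h).1
      · exact absurd ht (hs K hK).1
    · exact absurd ht (hs K hK).2
    · exact absurd ht hc
  | finish i' j' K' F _ _ h1 _ h2 _ hF _ =>
    rcases ht with ⟨K, hK, ht | ht⟩ | ht
    · exact absurd (by simpa using hF ht) (hs K hK).1
    · exact absurd ht (hs K hK).2
    -- Finishing creates no product: the partial sum it consumes must already contain the term.
    · rcases Set.mem_insert_iff.1 ht with h | h
      · cases h
        exact absurd h1 (hs K' (h2 k hkj hik hjk)).1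
      · exact absurd h hc

/-! ### Compulsory loads of the diagonal -/

/-- The state has a diagonal input entry, or some successor of it, in fast memory. -/
def State.HasDiag (s : State N) (i : Fin N) : Prop :=
  (∃ K, none ∈ K ∧ Word.part i i K ∈ s.fast) ∨ (i, i) ∈ s.computed

/-- Only a load can bring in the input term: accumulators start without it, sums inherit it from an
operand, and finishing requires it since `B i i ≠ 0`. -/
theorem Step.exists_hasDiag {s t : State N} {d : ℕ} (h : Step M B Nz s d t)
    (hB : ∀ i, B i i ≠ 0) :
    ∃ X : Finset (Fin N), X.card ≤ d ∧ ∀ i, t.HasDiag i → s.HasDiag i ∨ i ∈ X := by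
  unfold State.HasDiag
  cases h with
  | load w F hw hF _ =>
    refine ⟨{w.pos.1}, by simp, fun i ht => ?_⟩
    rcases ht with ⟨K, hK, ht⟩ | ht
    · rcases Finset.mem_insert.1 (hF ht) with rfl | ht
      · exact Or.inr (Finset.mem_singleton.2 rfl)
      · exact Or.inl (Or.inl ⟨K, hK, ht⟩)
    · exact Or.inl (Or.inr ht)
  | store w hw => exact ⟨∅, by simp, fun i ht => Or.inl ht⟩
  | discard F hF =>
    exact ⟨∅, by simp, fun i ht => Or.inl (ht.imp_left fun ⟨K, hK, h⟩ => ⟨K, hK, hF h⟩)⟩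
  | zero i' j' F _ hF _ =>
    refine ⟨∅, by simp, fun i ht => Or.inl (ht.imp_left fun ⟨K, hK, h⟩ => ?_)⟩
    rcases Finset.mem_insert.1 (hF h) with h | h
    · cases h
      exact absurd hK (Finset.notMem_empty _)
    · exact ⟨K, hK, h⟩
  | multiply i' j' k' K' F _ _ _ h1 h2 h3 hF _ =>
    refine ⟨∅, by simp, fun i ht => Or.inl (ht.imp_left fun ⟨K, hK, h⟩ => ?_)⟩
    rcases Finset.mem_insert.1 (hF h) with h | h
    · cases h
      exact ⟨K', by simpa using hK, h3⟩
    · exact ⟨K, hK, h⟩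
  | add i' j' K₁ K₂ F _ h1 h2 hF _ =>
    refine ⟨∅, by simp, fun i ht => Or.inl (ht.imp_left fun ⟨K, hK, h⟩ => ?_)⟩
    rcases Finset.mem_insert.1 (hF h) with h | h
    · cases h
      rcases Finset.mem_union.1 hK with h | h
      · exact ⟨_, h, h1⟩
      · exact ⟨_, h, h2⟩
    · exact ⟨K, hK, h⟩
  | finish i' j' K' F _ _ h1 h2 _ _ hF _ =>
    refine ⟨∅, by simp, fun i ht => Or.inl ?_⟩
    rcases ht with ⟨K, hK, ht⟩ | ht
    · exact Or.inl ⟨K, hK, by simpa using hF ht⟩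
    · rcases Set.mem_insert_iff.1 ht with h | h
      · cases h
        exact Or.inl ⟨K', h2 (hB _), h1⟩
      · exact Or.inr h

/-- Every diagonal entry of the input has to be loaded. -/
theorem Run.card_hasDiag_le {s t : State N} {W : ℕ} (h : Run M B Nz s W t)
    (hB : ∀ i, B i i ≠ 0) (hs : ∀ i, ¬ s.HasDiag i) :
    ∃ X : Finset (Fin N), X.card ≤ W ∧ ∀ i, t.HasDiag i → i ∈ X := by
  classical
  induction h with
  | nil => exact ⟨∅, by simp, fun i hi => absurd hi (hs i)⟩
  | snoc t u W d _ hstep ih =>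
    obtain ⟨X, hX, hX'⟩ := ih
    obtain ⟨Y, hY, hY'⟩ := hstep.exists_hasDiag hB
    refine ⟨X ∪ Y, (Finset.card_union_le _ _).trans (add_le_add hX hY), fun i hi => ?_⟩
    exact Finset.mem_union.2 ((hY' i hi).imp_left (hX' i))

/-! ### Executions as sequences of states -/

/-- The states `s 0, …, s T` of an execution, with the numbers `w r` of words moved before time `r`. -/
structure IsTrace (M : ℕ) (B : Matrix (Fin N) (Fin N) ℝ) (Nz : Fin N → Fin N → Prop) (T : ℕ)
    (s : ℕ → State N) (w : ℕ → ℕ) : Prop where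
  init : s 0 = State.initial N
  cost_zero : w 0 = 0
  step : ∀ r < T, ∃ d, Step M B Nz (s r) d (s (r + 1)) ∧ w (r + 1) = w r + d

theorem Run.exists_isTrace {t : State N} {W : ℕ} (h : Run M B Nz (State.initial N) W t) :
    ∃ T s w, IsTrace M B Nz T s w ∧ s T = t ∧ w T = W := by
  induction h with
  | nil =>
    exact ⟨0, fun _ => State.initial N, fun _ => 0, ⟨rfl, rfl, fun r hr => absurd hr (Nat.not_lt_zero r)⟩,
      rfl, rfl⟩
  | snoc t u W d _ hstep ih =>
    obtain ⟨T, s, w, ⟨h0, h1, h2⟩, rfl, rfl⟩ := ih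
    refine ⟨T + 1, fun r => if r ≤ T then s r else u, fun r => if r ≤ T then w r else w T + d,
      ⟨by simpa using h0, by simpa using h1, fun r hr => ?_⟩, by simp, by simp⟩
    rcases Nat.lt_succ_iff_lt_or_eq.1 hr with hr | rfl
    · obtain ⟨e, he⟩ := h2 r hr
      exact ⟨e, by simpa [hr.le, Nat.succ_le_of_lt hr] using he⟩
    · exact ⟨d, by simpa using hstep⟩

namespace IsTrace

variable {T : ℕ} {s : ℕ → State N} {w : ℕ → ℕ}

theorem cost_mono (h : IsTrace M B Nz T s w) {a b : ℕ} (hab : a ≤ b) (hb : b ≤ T) : w a ≤ w b := by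
  induction b, hab using Nat.le_induction with
  | base => exact le_rfl
  | succ b hab ih =>
    obtain ⟨d, -, hd⟩ := h.step b hb
    have := ih (by omega)
    omega

theorem slow_mono (h : IsTrace M B Nz T s w) {a b : ℕ} (hab : a ≤ b) (hb : b ≤ T) :
    (s a).slow ⊆ (s b).slow := by
  induction b, hab using Nat.le_induction with
  | base => exact subset_rfl
  | succ b hab ih =>
    obtain ⟨d, hd, -⟩ := h.step b hb
    exact (ih (by omega)).trans hd.slow_subset

theorem computed_mono (h : IsTrace M B Nz T s w) {a b : ℕ} (hab : a ≤ b) (hb : b ≤ T) :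
    (s a).computed ⊆ (s b).computed := by
  induction b, hab using Nat.le_induction with
  | base => exact subset_rfl
  | succ b hab ih =>
    obtain ⟨d, hd, -⟩ := h.step b hb
    exact (ih (by omega)).trans hd.computed_subset

theorem card_fast_le (h : IsTrace M B Nz T s w) {r : ℕ} (hr : r ≤ T) : (s r).fast.card ≤ M := by
  induction r with
  | zero => simp [h.init, State.initial]
  | succ r ih =>
    obtain ⟨d, hd, -⟩ := h.step r hr
    exact hd.card_fast_le (ih (by omega))

theorem computed_of_avail (h : IsTrace M B Nz T s w) {r : ℕ} (hr : r ≤ T) :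
    ∀ i j, (s r).Avail (.entry i j) → (i, j) ∈ (s r).computed := by
  induction r with
  | zero => simp [h.init, State.initial, State.Avail]
  | succ r ih =>
    obtain ⟨d, hd, -⟩ := h.step r hr
    exact hd.computed_of_avail (ih (by omega))

/-- Thus a needed entry computed within a segment is, at the end of the segment, still in fast
memory or has been stored. -/
theorem avail_of_computed (h : IsTrace M B Nz T s w) {i j : Fin N}
    (hT : (s T).Avail (.entry i j)) {r : ℕ} (hr : r ≤ T) (hc : (i, j) ∈ (s r).computed) :
    (s r).Avail (.entry i j) := by
  induction hr using Nat.decreasingInduction with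
  | self => exact hT
  | of_succ r hr ih =>
    obtain ⟨d, hd, -⟩ := h.step r hr
    exact hd.avail_of_computed hc (ih (hd.computed_subset hc))

/-! ### Products formed in a segment -/

/-- The words moved between two times. -/
theorem exists_moved (h : IsTrace M B Nz T s w) {a b : ℕ} (hab : a ≤ b) (hb : b ≤ T) :
    ∃ X : Finset (Word N), X.card + w a ≤ w b ∧ (∀ v ∈ (s b).slow, v ∈ (s a).slow ∨ v ∈ X) ∧
      ∀ r, a ≤ r → r ≤ b → ∀ i j, Word.entry i j ∈ (s r).fast →
        Word.entry i j ∈ (s a).fast ∨ Word.entry i j ∈ X ∨ (i, j) ∉ (s a).computed := by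
  induction b, hab using Nat.le_induction with
  | base =>
    refine ⟨∅, by simp, fun v hv => Or.inl hv, fun r h1 h2 i j he => ?_⟩
    obtain rfl : r = a := by omega
    exact Or.inl he
  | succ b hab ih =>
    obtain ⟨X, hX, hX1, hX2⟩ := ih (by omega)
    obtain ⟨d, hstep, hd⟩ := h.step b hb
    obtain ⟨Y, hY, hY1, hY2⟩ := hstep.exists_moved
    refine ⟨X ∪ Y, ?_, fun v hv => ?_, fun r h1 h2 i j he => ?_⟩
    · have := Finset.card_union_le X Y
      omega
    · rcases hY1 v hv with hv | hv
      · exact (hX1 v hv).imp_right fun h => Finset.mem_union_left _ h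
      · exact Or.inr (Finset.mem_union_right _ hv)
    · have hle : ∀ r, a ≤ r → r ≤ b → Word.entry i j ∈ (s r).fast →
          Word.entry i j ∈ (s a).fast ∨ Word.entry i j ∈ X ∪ Y ∨ (i, j) ∉ (s a).computed :=
        fun r h1 h2 he => (hX2 r h1 h2 i j he).imp_right
          fun h => h.imp_left fun h => Finset.mem_union_left _ h
      rcases Nat.le_or_eq_of_le_succ h2 with h2 | rfl
      · exact hle r h1 h2 he
      · rcases hY2 i j he with he | he | he
        · exact hle b hab le_rfl he
        · exact Or.inr (Or.inl (Finset.mem_union_right _ he))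
        · exact Or.inr (Or.inr fun hc => he (h.computed_mono hab (by omega) hc))

/-- In a part of an execution that moves at most `M` words, the products that are formed, and
retained from then on, involve at most `3 * M` positions of the matrix. -/
theorem exists_positions (h : IsTrace M B Nz T s w)
    (hT : ∀ i j, j ≤ i → Nz i j → (s T).Avail (.entry i j)) {a b : ℕ} (hab : a ≤ b) (hb : b ≤ T)
    (hw : w b ≤ w a + M) :
    ∃ P : Finset (Fin N × Fin N), P.card ≤ 3 * M ∧
      ∀ i j k r, k < j → j ≤ i → Nz i j → Nz i k → Nz j k → a ≤ r → r < b →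
        ¬ (s r).Holds i j (some k) → (∀ r', r < r' → r' ≤ T → (s r').Holds i j (some k)) →
        (i, j) ∈ P ∧ (i, k) ∈ P ∧ (j, k) ∈ P := by
  obtain ⟨X, hX, hX1, hX2⟩ := h.exists_moved hab hb
  -- Three sources of at most `M` words each: initial fast memory, words moved, final fast memory.
  let Y : Finset (Word N) := (s a).fast ∪ X ∪ (s b).fast
  have hY : Y.card ≤ 3 * M := by
    have h1 := Finset.card_union_le ((s a).fast ∪ X) (s b).fast
    have h2 := Finset.card_union_le (s a).fast X
    have h3 := h.card_fast_le (hab.trans hb)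
    have h4 := h.card_fast_le hb
    simp only [Y]
    omega
  have hnew : ∀ i j, j ≤ i → Nz i j → (i, j) ∈ (s b).computed → (i, j) ∉ (s a).computed →
      Word.entry i j ∈ Y := by
    intro i j hji hz hcb hca
    rcases h.avail_of_computed (hT i j hji hz) hb hcb with hf | hsl
    · exact Finset.mem_union_right _ hf
    · rcases hX1 _ hsl with hsl | hx
      · exact absurd (h.computed_of_avail (hab.trans hb) i j (Or.inr hsl)) hca
      · exact Finset.mem_union_left _ (Finset.mem_union_right _ hx)
  have hentry : ∀ r, a ≤ r → r < b → ∀ i j, j ≤ i → Nz i j → Word.entry i j ∈ (s r).fast →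
      Word.entry i j ∈ Y := by
    intro r har hrb i j hji hz he
    rcases hX2 r har hrb.le i j he with hf | hx | hc
    · exact Finset.mem_union_left _ (Finset.mem_union_left _ hf)
    · exact Finset.mem_union_left _ (Finset.mem_union_right _ hx)
    · exact hnew i j hji hz (h.computed_mono hrb.le hb
        (h.computed_of_avail (by omega) i j (Or.inl he))) hc
  refine ⟨Y.image Word.pos, Finset.card_image_le.trans hY,
    fun i j k r hkj hji hij hik hjk har hrb hno hall => ?_⟩
  obtain ⟨d, hstep, -⟩ := h.step r (by omega)
  obtain ⟨h1, h2⟩ := hstep.multiplied hkj hik hjk hno (hall _ (Nat.lt_succ_self r) (by omega))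
  refine ⟨?_, Finset.mem_image.2 ⟨_, hentry r har hrb i k (hkj.le.trans hji) hik h1, rfl⟩,
    Finset.mem_image.2 ⟨_, hentry r har hrb j k hkj.le hjk h2, rfl⟩⟩
  -- At time `b` the product survives in a partial sum or a finished entry. That word was not in
  -- slow memory, nor that entry computed, at time `a`; otherwise the product would be retained at
  -- time `r`.
  rcases hall b hrb hb with ⟨K, hK, hf | hsl⟩ | hc
  · exact Finset.mem_image.2 ⟨_, Finset.mem_union_right _ hf, rfl⟩
  · rcases hX1 _ hsl with hsl | hx
    · exact absurd (Or.inl ⟨K, hK, Or.inr (h.slow_mono har (by omega) hsl)⟩) hno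
    · exact Finset.mem_image.2 ⟨_, Finset.mem_union_left _ (Finset.mem_union_right _ hx), rfl⟩
  · refine Finset.mem_image.2 ⟨_, hnew i j hji hij hc fun hca => hno (Or.inr ?_), rfl⟩
    exact h.computed_mono har (by omega) hca

/-- Every product that is needed is formed at some time, and retained from then on. -/
theorem exists_formed (h : IsTrace M B Nz T s w)
    (hT : ∀ i j, j ≤ i → Nz i j → (s T).Avail (.entry i j)) {i j : Fin N} (k : Fin N)
    (hji : j ≤ i) (hij : Nz i j) :
    ∃ r < T, ¬ (s r).Holds i j (some k) ∧
      ∀ r', r < r' → r' ≤ T → (s r').Holds i j (some k) := by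
  classical
  have h0 : ¬ (s 0).Holds i j (some k) := by
    rw [h.init]
    rintro (⟨K, hK, ht | ⟨i', j', -, ht⟩⟩ | ht)
    · exact absurd ht (Finset.notMem_empty _)
    · cases ht
      simp at hK
    · exact ht
  have hend : (s T).Holds i j (some k) :=
    Or.inr (h.computed_of_avail le_rfl i j (hT i j hji hij))
  -- Partial sums may be discarded and products formed again. The last time without retention
  -- assigns each product one definite formation.
  have hspec := Nat.findGreatest_spec (P := fun r => ¬ (s r).Holds i j (some k)) (Nat.zero_le T) h0
  refine ⟨_, lt_of_le_of_ne (Nat.findGreatest_le T) fun he => ?_, hspec, fun r' h1 h2 => ?_⟩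
  · rw [he] at hspec
    exact hspec hend
  · exact not_not.1 (Nat.findGreatest_is_greatest h1 h2)

/-- The number of needed products is at most the number of segments with `M` words moved, times the
number of products that can be formed in a segment. -/
theorem card_sq_le (h : IsTrace M B Nz T s w)
    (hT : ∀ i j, j ≤ i → Nz i j → (s T).Avail (.entry i j)) (hM : 1 ≤ M)
    (D : Finset (Fin N × Fin N × Fin N))
    (hD : ∀ i j k, (i, j, k) ∈ D → k < j ∧ j ≤ i ∧ Nz i j ∧ Nz i k ∧ Nz j k) :
    D.card ^ 2 ≤ (3 * M) ^ 3 * (w T / M + 1) ^ 2 := by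
  classical
  have hform : ∀ d : Fin N × Fin N × Fin N, ∃ r, d ∈ D → r < T ∧
      ¬ (s r).Holds d.1 d.2.1 (some d.2.2) ∧
      ∀ r', r < r' → r' ≤ T → (s r').Holds d.1 d.2.1 (some d.2.2) := fun d => by
    by_cases hd : d ∈ D
    · obtain ⟨-, h1, h2, -, -⟩ := hD _ _ _ hd
      obtain ⟨r, hr⟩ := h.exists_formed hT d.2.2 h1 h2
      exact ⟨r, fun _ => hr⟩
    · exact ⟨0, fun h => absurd h hd⟩
  choose τ hτ using hform
  have hfib : ∀ q ∈ Finset.range (w T / M + 1),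
      {d ∈ D | w (τ d) / M = q}.card ≤ Nat.sqrt ((3 * M) ^ 3) := by
    intro q _
    set E := {d ∈ D | w (τ d) / M = q} with hE
    rcases E.eq_empty_or_nonempty with hemp | hne
    · simp [hemp]
    obtain ⟨x, hx, hmin⟩ := E.exists_min_image τ hne
    obtain ⟨y, hy, hmax⟩ := E.exists_max_image τ hne
    have hyT := (hτ y (Finset.mem_filter.1 hy).1).1
    obtain ⟨e, he, hwe⟩ := h.step (τ y) hyT
    have hle := he.cost_le_one
    -- Since `w (τ y) < (q + 1) * M` and the forming instruction costs at most one word, the segment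
    -- through that instruction still fits in `M` words.
    have hcost : w (τ y + 1) ≤ w (τ x) + M := by
      have hxq := (Finset.mem_filter.1 hx).2
      have hyq := (Finset.mem_filter.1 hy).2
      have h1 := Nat.div_mul_le_self (w (τ x)) M
      have h2 := Nat.lt_div_mul_add (a := w (τ y)) hM
      rw [hxq] at h1
      rw [hyq] at h2
      omega
    obtain ⟨P, hP, hP'⟩ := h.exists_positions hT
      (Nat.le_succ_of_le (hmin y hy)) (Nat.succ_le_of_lt hyT) hcost
    rw [Nat.le_sqrt']
    refine (card_sq_le_card_pow_three E P fun i j k hd => ?_).trans (Nat.pow_le_pow_left hP 3)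
    have hdD := (Finset.mem_filter.1 hd).1
    obtain ⟨h1, h2, h3, h4, h5⟩ := hD _ _ _ hdD
    exact hP' i j k (τ (i, j, k)) h1 h2 h3 h4 h5 (hmin _ hd) (Nat.lt_succ_of_le (hmax _ hd))
      (hτ _ hdD).2.1 (hτ _ hdD).2.2
  have hcard := Finset.card_le_mul_card_image_of_maps_to (s := D) (f := fun d => w (τ d) / M)
    (t := Finset.range (w T / M + 1)) (fun d hd => by
      have h1 := h.cost_mono (hτ d hd).1.le le_rfl
      simpa using Nat.lt_succ_of_le (Nat.div_le_div_right (c := M) h1)) _ hfib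
  rw [Finset.card_range] at hcard
  calc D.card ^ 2 ≤ (Nat.sqrt ((3 * M) ^ 3) * (w T / M + 1)) ^ 2 := Nat.pow_le_pow_left hcard 2
    _ = Nat.sqrt ((3 * M) ^ 3) ^ 2 * (w T / M + 1) ^ 2 := mul_pow _ _ _
    _ ≤ _ := Nat.mul_le_mul_right _ (Nat.sqrt_le' _)

end IsTrace

end SparseCholesky

namespace SparseCholesky

/-! ### The lower bound -/

theorem FactorsWith.card_diag_le {N M W : ℕ} {B : Matrix (Fin N) (Fin N) ℝ}
    {Nz : Fin N → Fin N → Prop} (hd : ∀ i, B i i ≠ 0) (hNz : ∀ i, Nz i i)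
    (h : FactorsWith M B Nz W) : N ≤ W := by
  obtain ⟨t, hrun, ht⟩ := h
  obtain ⟨X, hX, hX'⟩ := hrun.card_hasDiag_le hd (by simp [State.HasDiag, State.initial])
  obtain ⟨T, s, w, htr, rfl, rfl⟩ := hrun.exists_isTrace
  have huniv : X = Finset.univ := Finset.eq_univ_iff_forall.2 fun i =>
    hX' i (Or.inr (htr.computed_of_avail le_rfl i i (ht i i le_rfl (hNz i))))
  simpa [huniv] using hX

/-- A dense block of order `3 * m` in the factor forces communication. -/
theorem FactorsWith.pow_six_le {N M W m : ℕ} {B : Matrix (Fin N) (Fin N) ℝ}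
    {Nz : Fin N → Fin N → Prop} (hM : 1 ≤ M) (h : FactorsWith M B Nz W) {S : Finset (Fin N)}
    (hS : ∀ i ∈ S, ∀ j ∈ S, j ≤ i → Nz i j) (hm : 3 * m ≤ S.card) :
    m ^ 6 ≤ (3 * M) ^ 3 * (W / M + 1) ^ 2 := by
  classical
  obtain ⟨t, hrun, ht⟩ := h
  obtain ⟨T, s, w, htr, rfl, rfl⟩ := hrun.exists_isTrace
  let e := S.orderEmbOfFin rfl
  -- Taking `k`, `j`, `i` from the first, second and last thirds makes `k < j < i` automatic.
  let g : Fin m × Fin m × Fin m → Fin N × Fin N × Fin N := fun x =>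
    (e ⟨2 * m + x.1, by omega⟩, e ⟨m + x.2.1, by omega⟩, e ⟨x.2.2, by omega⟩)
  have hg : Function.Injective g := by
    rintro ⟨a, b, c⟩ ⟨a', b', c'⟩ h
    simp only [g, Prod.mk.injEq, e.injective.eq_iff, Fin.mk.injEq] at h
    simp only [Prod.mk.injEq, Fin.ext_iff]
    omega
  have hcard : (Finset.univ.image g).card = m ^ 3 := by
    rw [Finset.card_image_of_injective _ hg]
    simp
    ring
  have key := htr.card_sq_le ht hM (Finset.univ.image g) fun i j k hijk => by
    obtain ⟨⟨a, b, c⟩, -, hx⟩ := Finset.mem_image.1 hijk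
    simp only [g, Prod.mk.injEq] at hx
    obtain ⟨rfl, rfl, rfl⟩ := hx
    have hmem : ∀ x, e x ∈ S := S.orderEmbOfFin_mem rfl
    have h1 : e ⟨c, by omega⟩ < e ⟨m + b, by omega⟩ :=
      e.lt_iff_lt.2 (by rw [Fin.mk_lt_mk]; omega)
    have h2 : e ⟨m + b, by omega⟩ < e ⟨2 * m + a, by omega⟩ :=
      e.lt_iff_lt.2 (by rw [Fin.mk_lt_mk]; omega)
    exact ⟨h1, h2.le, hS _ (hmem _) _ (hmem _) h2.le,
      hS _ (hmem _) _ (hmem _) (h1.trans h2).le, hS _ (hmem _) _ (hmem _) h1.le⟩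
  calc m ^ 6 = (m ^ 3) ^ 2 := by ring
    _ ≤ _ := hcard ▸ key

theorem FactorsWith.lower_bound {n M W : ℕ} (hn : 1 ≤ n) (hM : 1 ≤ M)
    {B : Matrix (Fin (n * n)) (Fin (n * n)) ℝ} {Nz : Fin (n * n) → Fin (n * n) → Prop}
    (σ : Fin n × Fin n ≃ Fin (n * n)) (hd : ∀ i, B i i ≠ 0)
    (hadj : ∀ p q, (grid n).Adj p q → B (σ p) (σ q) ≠ 0)
    (hNz : ∀ i j, StructNonzero B i j → Nz i j) (h : FactorsWith M B Nz W) :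
    n ^ 6 ≤ M * (2592 * W) ^ 2 := by
  have hW : n * n ≤ W := h.card_diag_le hd fun i => hNz _ _ (.input _ _ le_rfl (hd i))
  have hW4 : (n * n) ^ 2 ≤ W ^ 2 := Nat.pow_le_pow_left hW 2
  -- Small `n` and `M ≥ n ^ 2` follow from `W ≥ n ^ 2` alone.
  rcases lt_or_ge n 6 with hn6 | hn6
  · calc n ^ 6 = n ^ 2 * (n * n) ^ 2 := by ring
      _ ≤ 6 ^ 2 * W ^ 2 := Nat.mul_le_mul (Nat.pow_le_pow_left hn6.le 2) hW4
      _ ≤ M * (2592 * W) ^ 2 := by nlinarith [Nat.mul_le_mul_right (W ^ 2) hM]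
  rcases le_total (n * n) M with hnM | hnM
  · calc n ^ 6 = n * n * (n * n) ^ 2 := by ring
      _ ≤ M * W ^ 2 := Nat.mul_le_mul hnM hW4
      _ ≤ M * (2592 * W) ^ 2 := Nat.mul_le_mul_left _ (Nat.pow_le_pow_left (by omega) 2)
  obtain ⟨S, hS, hS'⟩ := exists_clique hn σ hadj
  have key := h.pow_six_le (m := (n - 1) / 3) hM
    (fun i hi j hj hji => hNz _ _ (hS' i hi j hj hji)) (by omega)
  -- The incomplete last segment is absorbed by `M ≤ n ^ 2 ≤ W`.
  have hseg : M * (W / M + 1) ≤ 2 * W := by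
    have := Nat.mul_div_le W M
    rw [mul_add]
    omega
  -- The rounding loss is covered by the factor `6` once `n ≥ 6`. The final constant works because
  -- `6 ^ 6 * 27 * 4 ≤ 6 ^ 6 * 144 = 2592 ^ 2`.
  calc n ^ 6 ≤ (6 * ((n - 1) / 3)) ^ 6 := Nat.pow_le_pow_left (by omega) 6
    _ = 6 ^ 6 * ((n - 1) / 3) ^ 6 := mul_pow _ _ _
    _ ≤ 6 ^ 6 * ((3 * M) ^ 3 * (W / M + 1) ^ 2) := Nat.mul_le_mul_left _ key
    _ = 6 ^ 6 * 27 * M * (M * (W / M + 1)) ^ 2 := by ring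
    _ ≤ 6 ^ 6 * 27 * M * (2 * W) ^ 2 := Nat.mul_le_mul_left _ (Nat.pow_le_pow_left hseg 2)
    _ ≤ M * (2592 * W) ^ 2 := by nlinarith [Nat.zero_le (M * W ^ 2)]

theorem le_of_pow_six_le {n M W : ℕ} (hM : 1 ≤ M) (h : n ^ 6 ≤ M * (2592 * W) ^ 2) :
    (1 / 2592 : ℝ) * ((n : ℝ) ^ 3 / √(M : ℝ)) ≤ (W : ℝ) := by
  have hM' : (0 : ℝ) < √(M : ℝ) := Real.sqrt_pos.2 (by exact_mod_cast hM)
  have h' : ((n : ℝ) ^ 3) ^ 2 ≤ (√(M : ℝ) * (2592 * W)) ^ 2 := by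
    rw [mul_pow, Real.sq_sqrt (Nat.cast_nonneg M), ← pow_mul]
    exact_mod_cast h
  have h3 : (n : ℝ) ^ 3 / √(M : ℝ) ≤ 2592 * W := by
    rw [div_le_iff₀' hM']
    exact (sq_le_sq₀ (by positivity) (by positivity)).1 h'
  linarith

end SparseCholesky

theorem mainTheorem8 :
    ∃ c : ℝ, 0 < c ∧
      ∀ (n M : ℕ), 1 ≤ n → 1 ≤ M →
      ∀ (A : Matrix (Fin n × Fin n) (Fin n × Fin n) ℝ) (σ : Fin n × Fin n ≃ Fin (n * n)),
        -- a five-point matrix, where only multiplications by exact zeros of its factor are skipped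
        (SparseCholesky.IsFivePointMatrix A →
          ∀ L : Matrix (Fin (n * n)) (Fin (n * n)) ℝ,
            SparseCholesky.IsCholeskyFactor (SparseCholesky.reorder A σ) L →
            ∀ W : ℕ,
              SparseCholesky.FactorsWith M (SparseCholesky.reorder A σ)
                (fun i j => L i j ≠ 0) W →
              c * ((n : ℝ) ^ 3 / √(M : ℝ)) ≤ (W : ℝ)) ∧
        -- any matrix that contains the structure, where only structural zeros are exploited
        (A.PosDef → (∀ p q, (SparseCholesky.grid n).Adj p q → A p q ≠ 0) →
          ∀ W : ℕ,
            SparseCholesky.FactorsWith M (SparseCholesky.reorder A σ)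
              (SparseCholesky.StructNonzero (SparseCholesky.reorder A σ)) W →
            c * ((n : ℝ) ^ 3 / √(M : ℝ)) ≤ (W : ℝ)) := by
  refine ⟨1 / 2592, by norm_num, fun n M hn hM A σ => ⟨fun hA L hL W hW => ?_, fun hA hadj W hW => ?_⟩⟩
  · have hB : ∀ i j, i ≠ j → SparseCholesky.reorder A σ i j ≤ 0 := fun i j hij => by
      have h := hA (σ.symm i) (σ.symm j) (σ.symm.injective.ne hij)
      by_cases hadj : (SparseCholesky.grid n).Adj (σ.symm i) (σ.symm j)
      · exact (h.1 hadj).le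
      · exact (h.2 hadj).le
    refine SparseCholesky.le_of_pow_six_le hM (hW.lower_bound hn hM σ (fun i => (hL.diag_pos i).ne')
      (fun p q hpq => ?_) fun i j => hL.ne_zero_of_structNonzero hB)
    simpa [SparseCholesky.reorder] using ((hA p q hpq.ne).1 hpq).ne
  · refine SparseCholesky.le_of_pow_six_le hM (hW.lower_bound hn hM σ (fun i => hA.diag_pos.ne')
      (fun p q hpq => ?_) fun i j h => h)
    simpa [SparseCholesky.reorder] using hadj p q hpq
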